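/- **Theorem 1.2.** Let $k\in[0,1)$ and let $n\ge 1$ be an integer with $$n\le N(k):=\frac{1-2k+\sqrt{4k^2-4k+8}}{2(1-k)},\qquad p=p_1(n,k):=1+\frac{2}{(1-k)n}.$$ Let $R>0$, and let $u_0\in H^1(\mathbb R^n)$ and $u_1\in L^2(\mathbb R^n)$ be real-valued, nonnegative and nontrivial (each of the two is nonnegative a.e. and not a.e. zero), with supports contained in the ball $B_R$ of radius $R$ around the origin. For $\varepsilon>0$ consider the Cauchy problem $$u_{tt}-t^{-2k}\Delta u=t^{1-p}|u|^p\quad (x\in\mathbb R^n,\ t\in(1,T)),\qquad u(1,x)=\varepsilon u_0(x),\quad u_t(1,x)=\varepsilon u_1(x).\tag{1}$$ For $1<T\le\infty$, an *energy solution* of (1) on $[1,T)$ is a real-valued function $$u\in C([1,T),H^1(\mathbb R^n))\cap C^1([1,T),L^2(\mathbb R^n))\cap L^p_{\mathrm{loc}}([1,T)\times\mathbb R^n)$$ with $u(1,\cdot)=\varepsilon u_0$ in $H^1(\mathbb R^n)$ such that $$\int_{\mathbb R^n}\partial_tu(t,x)\psi(t,x)\,dx-\varepsilon\int_{\mathbb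 R^n}u_1(x)\psi(1,x)\,dx-\int_1^t\!\int_{\mathbb R^n}\big(\partial_tu(s,x)\,\psi_s(s,x)-s^{-2k}\nabla u(s,x)\cdot\nabla\psi(s,x)\big)dx\,ds=\int_1^t\!\int_{\mathbb R^n}s^{1-p}|u(s,x)|^p\psi(s,x)\,dx\,ds$$ for all $\psi\in C_0^\infty([1,T)\times\mathbb R^n)$ (not required to vanish at $t=1$) and all $t\in(1,T)$. Only energy solutions satisfying the support condition $$\operatorname{supp}u(t,\cdot)\subset B_{A_k(t)+R}\quad\text{for all }t\in(1,T),\qquad A_k(t):=\int_1^t\tau^{-k}\,d\tau,\tag{2}$$ are considered. The *lifespan* $T(\varepsilon)\in[-\infty,\infty]$ is the supremum of all $T\in(1,\infty]$ for which an energy solution of (1) on $[1,T)$ satisfying (2) exists (with $\sup\emptyset=-\infty$). Then there exist constants $\varepsilon_0>0$ and $C>0$, which may depend on $u_0,u_1,n,p,k,R$ but not on $\varepsilon$, $T$ or the solution, such that for every $\varepsilon\in(0,\varepsilon_0]$ every energy solution of (1) satisfying (2) blows up in finite time, that is, whenever such a solution exists on $[1,T)$ one has $T<\infty$, and moreover $$T\le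 \exp\big(C\varepsilon^{-(p-1)}\big),\qquad\text{so that also}\qquad T(\varepsilon)\le \exp\big(C\varepsilon^{-(p-1)}\big).$$ -/

import Mathlib

open MeasureTheory Set
open scoped ENNReal ContDiff Gradient

noncomputable section

namespace EdeS

/-- Euclidean space `ℝⁿ`. -/
abbrev Space (n : ℕ) : Type := EuclideanSpace ℝ (Fin n)

/-- The space `L²(ℝⁿ)` of real-valued functions. -/
abbrev L2 (n : ℕ) : Type := Lp ℝ 2 (volume : Measure (Space n))

/-- The space `L²(ℝⁿ; ℝⁿ)` of square integrable vector fields. -/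
abbrev L2Vec (n : ℕ) : Type := Lp (Space n) 2 (volume : Measure (Space n))

/-- `g` is the weak (distributional) gradient of `f`:
`∫ f ∂ᵢφ dx = - ∫ gᵢ φ dx` for every `φ ∈ C_c^∞(ℝⁿ)` and every `i`. -/
def IsWeakGradient {n : ℕ} (f : L2 n) (g : L2Vec n) : Prop :=
  ∀ φ : Space n → ℝ, ContDiff ℝ ∞ φ → HasCompactSupport φ → ∀ i : Fin n,
    ∫ x, f x * fderiv ℝ φ x (EuclideanSpace.single i 1) = - ∫ x, g x i * φ x

lemma integrable_mul_test {n : ℕ} {f : Space n → ℝ} (hf : MemLp f 2 volume)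
    {φ : Space n → ℝ} (hφ : Continuous φ) (hc : HasCompactSupport φ) :
    Integrable (fun x => f x * φ x) volume :=
  MemLp.integrable_mul (p := 2) (q := 2) hf (hφ.memLp_of_hasCompactSupport hc)

lemma memLp_coord {n : ℕ} (g : L2Vec n) (i : Fin n) :
    MemLp (fun x => g x i) 2 (volume : Measure (Space n)) :=
  (EuclideanSpace.proj i : Space n →L[ℝ] ℝ).comp_memLp' (Lp.memLp g)

lemma continuous_partial {n : ℕ} {φ : Space n → ℝ} (hφ : ContDiff ℝ ∞ φ) (i : Fin n) :
    Continuous fun x => fderiv ℝ φ x (EuclideanSpace.single i 1) :=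
  (hφ.continuous_fderiv (by simp)).clm_apply continuous_const

lemma hasCompactSupport_partial {n : ℕ} {φ : Space n → ℝ} (hc : HasCompactSupport φ)
    (i : Fin n) :
    HasCompactSupport fun x => fderiv ℝ φ x (EuclideanSpace.single i 1) :=
  hc.fderiv_apply ℝ (EuclideanSpace.single i 1)

/-- The space `H¹(ℝⁿ)` realised as the space of pairs `(f, ∇f)` in
`L²(ℝⁿ) × L²(ℝⁿ; ℝⁿ)` for which `∇f` is the weak gradient of `f`.  It carries the norm
`‖f‖² = ‖f‖²_{L²} + ‖∇f‖²_{L²}`. -/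
def H1Submodule (n : ℕ) : Submodule ℝ (WithLp 2 (L2 n × L2Vec n)) where
  carrier := {q | IsWeakGradient q.fst q.snd}
  zero_mem' := by
    intro φ _ _ i
    have h1 : ∫ x, (0 : L2 n) x * fderiv ℝ φ x (EuclideanSpace.single i 1) = 0 := by
      refine integral_eq_zero_of_ae ?_
      filter_upwards [Lp.coeFn_zero ℝ 2 (volume : Measure (Space n))] with x hx
      rw [hx]
      simp
    have h2 : ∫ x, (0 : L2Vec n) x i * φ x = 0 := by
      refine integral_eq_zero_of_ae ?_
      filter_upwards [Lp.coeFn_zero (Space n) 2 (volume : Measure (Space n))] with x hx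
      rw [hx]
      simp
    change ∫ x, (0 : L2 n) x * fderiv ℝ φ x (EuclideanSpace.single i 1)
      = - ∫ x, (0 : L2Vec n) x i * φ x
    rw [h1, h2, neg_zero]
  add_mem' := by
    intro a b ha hb φ hφ hc i
    have hp := continuous_partial hφ i
    have hpc := hasCompactSupport_partial hc i
    have h1 : ∫ x, (a.fst + b.fst : L2 n) x * fderiv ℝ φ x (EuclideanSpace.single i 1)
        = (∫ x, a.fst x * fderiv ℝ φ x (EuclideanSpace.single i 1))
          + ∫ x, b.fst x * fderiv ℝ φ x (EuclideanSpace.single i 1) := by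
      rw [← integral_add (integrable_mul_test (Lp.memLp a.fst) hp hpc)
        (integrable_mul_test (Lp.memLp b.fst) hp hpc)]
      refine integral_congr_ae ?_
      filter_upwards [Lp.coeFn_add a.fst b.fst] with x hx
      rw [hx]
      exact add_mul _ _ _
    have h2 : ∫ x, (a.snd + b.snd : L2Vec n) x i * φ x
        = (∫ x, a.snd x i * φ x) + ∫ x, b.snd x i * φ x := by
      rw [← integral_add (integrable_mul_test (memLp_coord a.snd i) hφ.continuous hc)
        (integrable_mul_test (memLp_coord b.snd i) hφ.continuous hc)]
      refine integral_congr_ae ?_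
      filter_upwards [Lp.coeFn_add a.snd b.snd] with x hx
      rw [hx]
      exact add_mul _ _ _
    have ha' := ha φ hφ hc i
    have hb' := hb φ hφ hc i
    change ∫ x, (a.fst + b.fst : L2 n) x * fderiv ℝ φ x (EuclideanSpace.single i 1)
      = - ∫ x, (a.snd + b.snd : L2Vec n) x i * φ x
    rw [h1, h2, ha', hb']
    ring
  smul_mem' := by
    intro c a ha φ hφ hc i
    have h1 : ∫ x, (c • a.fst : L2 n) x * fderiv ℝ φ x (EuclideanSpace.single i 1)
        = c * ∫ x, a.fst x * fderiv ℝ φ x (EuclideanSpace.single i 1) := by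
      rw [← integral_const_mul]
      refine integral_congr_ae ?_
      filter_upwards [Lp.coeFn_smul c a.fst] with x hx
      simp [hx, mul_assoc]
    have h2 : ∫ x, (c • a.snd : L2Vec n) x i * φ x = c * ∫ x, a.snd x i * φ x := by
      rw [← integral_const_mul]
      refine integral_congr_ae ?_
      filter_upwards [Lp.coeFn_smul c a.snd] with x hx
      simp [hx, mul_assoc]
    have ha' := ha φ hφ hc i
    change ∫ x, (c • a.fst : L2 n) x * fderiv ℝ φ x (EuclideanSpace.single i 1)
      = - ∫ x, (c • a.snd : L2Vec n) x i * φ x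
    rw [h1, h2, ha']
    ring

/-- The Sobolev space `H¹(ℝⁿ)`, a real normed space. -/
abbrev H1 (n : ℕ) : Type := H1Submodule n

/-- The underlying `L²` function of an element of `H¹`. -/
def H1.fn {n : ℕ} (f : H1 n) : L2 n := f.1.fst

/-- The weak gradient of an element of `H¹`. -/
def H1.grad {n : ℕ} (f : H1 n) : L2Vec n := f.1.snd

/-- The amplitude of the light cone, `A_k(t) = ∫₁ᵗ τ^{-k} dτ`. -/
def A (k t : ℝ) : ℝ := ∫ τ in (1 : ℝ)..t, τ ^ (-k)

/-- The dimension threshold `N(k) = (1 - 2k + √(4k² - 4k + 8)) / (2(1 - k))`. -/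
def N (k : ℝ) : ℝ := (1 - 2 * k + √(4 * k ^ 2 - 4 * k + 8)) / (2 * (1 - k))

/-- The critical exponent `p₁(n,k) = 1 + 2 / ((1 - k) n)`. -/
def p₁ (n : ℕ) (k : ℝ) : ℝ := 1 + 2 / ((1 - k) * n)

/-- `supp f ⊂ B_r` for (a class of) a measurable function: `f` vanishes almost everywhere outside
the ball of radius `r` around the origin (spheres are null sets, so the open and the closed
ball give the same condition). -/
def SupportedInBall {n : ℕ} (f : L2 n) (r : ℝ) : Prop :=
  ∀ᵐ x : Space n, r < ‖x‖ → f x = 0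

/-- The time interval `[1, T)`, where `T = ∞` is allowed. -/
def timeInterval (T : EReal) : Set ℝ := {t | 1 ≤ t ∧ (t : EReal) < T}

/-- The derivative `∂ₜu` of a curve `[1, T) → H¹`, taken in `L²`. -/
def timeDeriv {n : ℕ} (T : EReal) (u : ℝ → H1 n) (t : ℝ) : L2 n :=
  derivWithin (fun s => (u s).fn) (timeInterval T) t

/-- `u ∈ L^p_loc([1, T) × ℝⁿ)`: the curve `u` is represented by a function of `(t, x)` whose
`p`-th power is integrable over the compact subsets of `[1, T) × ℝⁿ`. -/
def MemLpLoc {n : ℕ} (p : ℝ) (T : EReal) (u : ℝ → H1 n) : Prop :=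
  ∃ U : ℝ × Space n → ℝ,
    (∀ᵐ t : ℝ, t ∈ timeInterval T → (fun x => U (t, x)) =ᵐ[volume] (u t).fn) ∧
    ∀ K : Set (ℝ × Space n), IsCompact K → K ⊆ timeInterval T ×ˢ univ →
      MemLp U (ENNReal.ofReal p) (volume.restrict K)

/-- Test functions `ψ ∈ C_0^∞([1, T) × ℝⁿ)`: restrictions to times `t ≥ 1` of smooth functions
on space-time whose support is compact and contained in `{t < T}`.  They need not vanish at
`t = 1`. -/
structure IsTestFunction {n : ℕ} (T : EReal) (ψ : ℝ × Space n → ℝ) : Prop where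
  smooth : ContDiff ℝ ∞ ψ
  compact : HasCompactSupport ψ
  support : ∀ z ∈ tsupport ψ, (z.1 : EReal) < T

/-- `u` is an energy solution on `[1, T)`, `1 < T ≤ ∞`, of the Cauchy problem
`u_tt - t^{-2k} Δu = t^{1-p} |u|^p`, `u(1,·) = ε u₀`, `u_t(1,·) = ε u₁`. Only the values of the
curve `u` on `[1, T)` matter. -/
structure IsEnergySolution {n : ℕ} (k p ε : ℝ) (u₀ : H1 n) (u₁ : L2 n) (T : EReal)
    (u : ℝ → H1 n) : Prop where
  one_lt : 1 < T
  /-- `u ∈ C([1,T), H¹(ℝⁿ))` -/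
  continuous_H1 : ContinuousOn u (timeInterval T)
  /-- `u ∈ C¹([1,T), L²(ℝⁿ))` -/
  contDiff_L2 : ContDiffOn ℝ 1 (fun t => (u t).fn) (timeInterval T)
  /-- `u ∈ L^p_loc([1,T) × ℝⁿ)` -/
  memLpLoc : MemLpLoc p T u
  /-- `u(1,·) = ε u₀` in `H¹(ℝⁿ)` -/
  initial : u 1 = ε • u₀
  /-- the integral relation -/
  integral_eq : ∀ ψ : ℝ × Space n → ℝ, IsTestFunction T ψ →
    ∀ t : ℝ, 1 < t → (t : EReal) < T →
      (∫ x, timeDeriv T u t x * ψ (t, x)) - ε * (∫ x, u₁ x * ψ (1, x))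
        - (∫ s in (1 : ℝ)..t, ∫ x,
            (timeDeriv T u s x * deriv (fun r => ψ (r, x)) s
              - s ^ (-2 * k) * inner ℝ ((u s).grad x) (∇ (fun y => ψ (s, y)) x)))
      = ∫ s in (1 : ℝ)..t, ∫ x, s ^ (1 - p) * |(u s).fn x| ^ p * ψ (s, x)

/-- The support condition `supp u(t,·) ⊂ B_{A_k(t)+R}` for all `t ∈ (1, T)`. -/
def HasConeSupport {n : ℕ} (k R : ℝ) (T : EReal) (u : ℝ → H1 n) : Prop :=
  ∀ t : ℝ, 1 < t → (t : EReal) < T → SupportedInBall (u t).fn (A k t + R)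

/-- The lifespan `T(ε)`: the maximal existence time of energy solutions with the support
condition, i.e. the supremum of all `T ∈ (1, ∞]` such that one exists on `[1, T)`. -/
def lifespan {n : ℕ} (k p R : ℝ) (u₀ : H1 n) (u₁ : L2 n) (ε : ℝ) : EReal :=
  sSup {T | ∃ u : ℝ → H1 n, IsEnergySolution k p ε u₀ u₁ T u ∧ HasConeSupport k R T u}

end EdeS

end

/-! The spatial mean `F(t) = ∫ u(t,x) dx` satisfies a critical ordinary differential inequality.
Since `u(t)` lives in a ball of radius `A k t + R`, a spatial cut-off equal to one near that ball
removes the Laplacian from the weak formulation, so `F'' = t^(1-p) ∫ |u|^p`. By Hölder the right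
side is at least a constant times `t^(1-p) (t^(1-k))^(-n(p-1)) |F|^p`, and the choice of `p` makes
`(1-k) n (p-1) = 2`, hence `F'' ≥ c t^(-1-p) |F|^p`.

This inequality is invariant under dilation of time if `G = F/t` is kept, so blow-up is decided on
the scale of `log t`. With `W = t F' - F` one has `G' = W/t²` and `W' ≥ c G^p`. Comparing `W` with
`κ t G^((p+1)/2)` gives `t G' ≥ κ G^((p+1)/2)`, an inequality whose solutions become infinite in
finite logarithmic time, at most of order `κ⁻¹ G(1)^(-(p-1)/2)`. For data of size `ε` both
`G(1)^((p-1)/2)` and the admissible `κ` are of order `ε^((p-1)/2)`, which produces `ε^(-(p-1))`.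

The differential part is `exists_log_le_of_deriv_growth`; the reduction to it is
`exists_log_le_of_isEnergySolution`, resting on `IsEnergySolution.integral_timeDeriv_mul_bump`,
`abs_integral_mul_rpow_le` and `volume_closedBall_rpow_le`. -/

namespace EdeS

/-! ### The critical differential inequality in logarithmic time -/

/-- A superlinear growth bound obtained by a first crossing argument: for `G' = W / t²` and
`W(t) - W(s) ≥ c ∫ₛᵗ Gᵖ`, the function `W` dominates `κ t G ^ ((p + 1) / 2)`. -/
lemma mul_rpow_le_of_integral_growth {p c g₀ κ B : ℝ} {G W : ℝ → ℝ} (hp : 1 < p)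
    (hG : ContinuousOn G (Icc 1 B)) (hW : ContinuousOn W (Icc 1 B))
    (hGW : ∀ t ∈ Ioo 1 B, HasDerivAt G (W t / t ^ 2) t)
    (hlow : ∀ t ∈ Icc 1 B, g₀ ≤ G t) (hg₀ : 0 < g₀) (hκ : 0 < κ)
    (hgrow : ∀ s t, 1 ≤ s → s ≤ t → t ≤ B → c * ∫ r in s..t, G r ^ p ≤ W t - W s)
    (hinit : κ * G 1 ^ ((p + 1) / 2) ≤ W 1)
    (hκ₁ : κ * g₀ ^ (-((p - 1) / 2)) ≤ c / 2) (hκ₂ : κ ^ 2 * ((p + 1) / 2) ≤ c / 2)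
    {t : ℝ} (ht : t ∈ Icc 1 B) : κ * (t * G t ^ ((p + 1) / 2)) ≤ W t := by
  by_contra! hlt
  set q := (p + 1) / 2 with hq
  have hGpos : ∀ r ∈ Icc 1 B, 0 < G r := fun r hr => hg₀.trans_le (hlow r hr)
  have hYc : ContinuousOn (fun r => κ * (r * G r ^ q)) (Icc 1 B) :=
    continuousOn_const.mul (continuousOn_id.mul
      (hG.rpow_const fun r hr => Or.inl (hGpos r hr).ne'))
  have hsub : Icc 1 t ⊆ Icc 1 B := Icc_subset_Icc_right ht.2
  -- `s` is the last time up to `t` at which the bound holds. After it `W` lies below the comparison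
  -- function, so `G' = W / r²` is bounded above and the comparison function grows slowly.
  obtain ⟨s, ⟨hsmem, hsle⟩, hsmax⟩ :
      ∃ s, IsGreatest {r | r ∈ Icc 1 t ∧ κ * (r * G r ^ q) ≤ W r} s := by
    refine IsCompact.exists_isGreatest ?_ ⟨1, ⟨le_rfl, ht.1⟩, by simpa using hinit⟩
    have hcl := (isClosed_Icc (a := (1 : ℝ)) (b := t)).isClosed_le (hYc.mono hsub) (hW.mono hsub)
    exact isCompact_Icc.of_isClosed_subset hcl fun r hr => hr.1
  have hst : s < t := by
    rcases hsmem.2.lt_or_eq with h | h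
    · exact h
    · subst h; exact absurd hsle (not_le.2 hlt)
  have hstB : Icc s t ⊆ Icc 1 B := Icc_subset_Icc hsmem.1 ht.2
  have hpc : ContinuousOn (fun r => G r ^ p) (Icc 1 B) :=
    hG.rpow_const fun r hr => Or.inl (hGpos r hr).ne'
  have hpi : IntegrableOn (fun r => G r ^ p) (Icc s t) :=
    (hpc.mono hstB).integrableOn_Icc
  -- After `s` the comparison function grows no faster than the guaranteed growth of `W`, so it
  -- cannot overtake `W` by time `t`.
  have hmono : MonotoneOn (fun r => c * (∫ x in s..r, G x ^ p) - κ * (r * G r ^ q))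
      (Icc s t) := by
    refine monotoneOn_of_hasDerivWithinAt_nonneg (convex_Icc s t)
      (f' := fun r => c * G r ^ p
        - κ * (1 * G r ^ q + r * (W r / r ^ 2 * q * G r ^ (q - 1)))) ?_ ?_ ?_
    · refine (continuousOn_const.mul ?_).sub (hYc.mono hstB)
      exact intervalIntegral.continuousOn_primitive_interval (by rwa [uIcc_of_le hst.le])
        |>.mono (by rw [uIcc_of_le hst.le])
    · intro r hr
      rw [interior_Icc] at hr ⊢
      have hrB : r ∈ Ioo 1 B := ⟨hsmem.1.trans_lt hr.1, hr.2.trans_le ht.2⟩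
      have hGr := hGpos r (Ioo_subset_Icc_self hrB)
      have h1 : HasDerivAt (fun y => ∫ x in s..y, G x ^ p) (G r ^ p) r := by
        refine intervalIntegral.integral_hasDerivAt_right ?_ ?_ ?_
        · rw [intervalIntegrable_iff_integrableOn_Icc_of_le hr.1.le]
          exact hpi.mono_set (Icc_subset_Icc_right hr.2.le)
        · exact (hpc.mono Ioo_subset_Icc_self).stronglyMeasurableAtFilter isOpen_Ioo r hrB
        · exact hpc.continuousAt (Icc_mem_nhds hrB.1 hrB.2)
      have h2 : HasDerivAt (fun y => y * G y ^ q)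
          (1 * G r ^ q + r * (W r / r ^ 2 * q * G r ^ (q - 1))) r :=
        (hasDerivAt_id r).mul ((hGW r hrB).rpow_const (Or.inl hGr.ne'))
      exact ((h1.const_mul c).sub (h2.const_mul κ)).hasDerivWithinAt
    · intro r hr
      rw [interior_Icc] at hr
      have hr1 : 1 < r := hsmem.1.trans_lt hr.1
      have hrpos : 0 < r := by linarith
      have hrB : r ∈ Icc 1 B := ⟨hr1.le, hr.2.le.trans ht.2⟩
      have hGr := hGpos r hrB
      have hWr : W r ≤ κ * (r * G r ^ q) := by
        by_contra! h
        exact absurd (hsmax ⟨⟨hr1.le, hr.2.le⟩, h.le⟩) (not_le.2 hr.1)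
      have e1 : G r ^ q = G r ^ p * G r ^ (-((p - 1) / 2)) := by
        rw [← Real.rpow_add hGr]; congr 1; rw [hq]; ring
      -- This identity, `2q - 1 = p`, dictates the exponent `q = (p + 1) / 2`.
      have e2 : G r ^ q * G r ^ (q - 1) = G r ^ p := by
        rw [← Real.rpow_add hGr]; congr 1; rw [hq]; ring
      have e3 : G r ^ (-((p - 1) / 2)) ≤ g₀ ^ (-((p - 1) / 2)) :=
        Real.rpow_le_rpow_of_nonpos hg₀ (hlow r hrB) (by linarith)
      have hPp : 0 < G r ^ p := Real.rpow_pos_of_pos hGr _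
      have hP1 : 0 < G r ^ (q - 1) := Real.rpow_pos_of_pos hGr _
      have b1 : κ * G r ^ q ≤ c / 2 * G r ^ p := by
        rw [e1]
        calc κ * (G r ^ p * G r ^ (-((p - 1) / 2)))
            = κ * G r ^ (-((p - 1) / 2)) * G r ^ p := by ring
          _ ≤ κ * g₀ ^ (-((p - 1) / 2)) * G r ^ p := by gcongr
          _ ≤ c / 2 * G r ^ p := by gcongr
      have b2 : κ * (r * (W r / r ^ 2 * q * G r ^ (q - 1))) ≤ c / 2 * G r ^ p := by
        have hq0 : 0 < q := by rw [hq]; linarith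
        calc κ * (r * (W r / r ^ 2 * q * G r ^ (q - 1)))
            ≤ κ * (r * (κ * (r * G r ^ q) / r ^ 2 * q * G r ^ (q - 1))) := by gcongr
          _ = κ ^ 2 * q * (G r ^ q * G r ^ (q - 1)) := by field_simp
          _ = κ ^ 2 * q * G r ^ p := by rw [e2]
          _ ≤ c / 2 * G r ^ p := by gcongr
      have : κ * (1 * G r ^ q + r * (W r / r ^ 2 * q * G r ^ (q - 1))) ≤ c * G r ^ p := by
        rw [mul_add, one_mul]; linarith
      linarith
  have h := hmono ⟨le_rfl, hst.le⟩ ⟨hst.le, le_rfl⟩ hst.le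
  have hg := hgrow s t hsmem.1 hst.le ht.2
  simp only [intervalIntegral.integral_same, mul_zero, zero_sub] at h
  linarith

/-- The bound `W ≥ κ t G^((p+1)/2)` turns `G' = W / t²` into a separable inequality. Integrating it
shows that `G^(-(p-1)/2)` loses at least `(p-1)/2 · κ` per unit of `log t`, and this quantity must
stay positive. Monotonicity of `G` supplies the lower bound `g₀ = G 1`. -/
lemma log_le_of_integral_growth {p c κ B : ℝ} {G W : ℝ → ℝ} (hp : 1 < p) (hc : 0 ≤ c)
    (hB : 1 ≤ B)
    (hG : ContinuousOn G (Icc 1 B)) (hW : ContinuousOn W (Icc 1 B))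
    (hGW : ∀ t ∈ Ioo 1 B, HasDerivAt G (W t / t ^ 2) t)
    (hpos : ∀ t ∈ Icc 1 B, 0 < G t) (hκ : 0 < κ)
    (hgrow : ∀ s t, 1 ≤ s → s ≤ t → t ≤ B → c * ∫ r in s..t, G r ^ p ≤ W t - W s)
    (hinit : κ * G 1 ^ ((p + 1) / 2) ≤ W 1)
    (hκ₁ : κ * G 1 ^ (-((p - 1) / 2)) ≤ c / 2) (hκ₂ : κ ^ 2 * ((p + 1) / 2) ≤ c / 2) :
    (p - 1) / 2 * κ * Real.log B ≤ G 1 ^ (-((p - 1) / 2)) := by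
  have h1B : (1 : ℝ) ∈ Icc 1 B := ⟨le_rfl, hB⟩
  have hG1 := hpos 1 h1B
  have hWnn : ∀ t ∈ Icc 1 B, 0 ≤ W t := by
    intro t ht
    have h1 := hgrow 1 t le_rfl ht.1 ht.2
    have h2 : 0 ≤ ∫ r in (1 : ℝ)..t, G r ^ p :=
      intervalIntegral.integral_nonneg ht.1 fun r hr =>
        (Real.rpow_pos_of_pos (hpos r ⟨hr.1, hr.2.trans ht.2⟩) _).le
    have h3 : 0 < κ * G 1 ^ ((p + 1) / 2) := mul_pos hκ (Real.rpow_pos_of_pos hG1 _)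
    nlinarith [mul_nonneg hc h2]
  have hGm : MonotoneOn G (Icc 1 B) := by
    refine monotoneOn_of_hasDerivWithinAt_nonneg (convex_Icc 1 B) hG
      (f' := fun t => W t / t ^ 2) ?_ ?_
    · intro r hr
      rw [interior_Icc] at hr
      exact (hGW r hr).hasDerivWithinAt
    · intro r hr
      exact div_nonneg (hWnn r (interior_subset hr)) (sq_nonneg r)
  have hlow : ∀ t ∈ Icc 1 B, G 1 ≤ G t := fun t ht => hGm h1B ht ht.1
  have hanti : AntitoneOn (fun t => G t ^ (-((p - 1) / 2)) + (p - 1) / 2 * κ * Real.log t)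
      (Icc 1 B) := by
    refine antitoneOn_of_hasDerivWithinAt_nonpos (convex_Icc 1 B)
      (f' := fun t => W t / t ^ 2 * (-((p - 1) / 2)) * G t ^ (-((p - 1) / 2) - 1)
        + (p - 1) / 2 * κ * t⁻¹) ?_ ?_ ?_
    · refine (hG.rpow_const fun r hr => Or.inl (hpos r hr).ne').add
        (continuousOn_const.mul (Real.continuousOn_log.mono ?_))
      intro r hr
      exact (zero_lt_one.trans_le hr.1).ne'
    · intro r hr
      rw [interior_Icc] at hr
      have hr0 : r ≠ 0 := (zero_lt_one.trans hr.1).ne'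
      exact (((hGW r hr).rpow_const (Or.inl (hpos r (Ioo_subset_Icc_self hr)).ne')).add
        ((Real.hasDerivAt_log hr0).const_mul _)).hasDerivWithinAt
    · intro r hr
      have hr := interior_subset hr
      have hr0 : 0 < r := zero_lt_one.trans_le hr.1
      have hGr := hpos r hr
      have key := mul_rpow_le_of_integral_growth hp hG hW hGW hlow hG1 hκ hgrow hinit hκ₁ hκ₂ hr
      have e : G r ^ ((p + 1) / 2) * G r ^ (-((p - 1) / 2) - 1) = 1 := by
        rw [← Real.rpow_add hGr, ← Real.rpow_zero (G r)]; congr 1; ring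
      have hP : 0 < G r ^ (-((p - 1) / 2) - 1) := Real.rpow_pos_of_pos hGr _
      have : κ * r⁻¹ ≤ W r / r ^ 2 * G r ^ (-((p - 1) / 2) - 1) := by
        calc κ * r⁻¹ = κ * (r * G r ^ ((p + 1) / 2)) / r ^ 2 * G r ^ (-((p - 1) / 2) - 1) := by
              rw [show κ * (r * G r ^ ((p + 1) / 2)) / r ^ 2 * G r ^ (-((p - 1) / 2) - 1)
                = κ * r / r ^ 2 * (G r ^ ((p + 1) / 2) * G r ^ (-((p - 1) / 2) - 1)) by ring, e]
              field_simp
          _ ≤ _ := by gcongr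
      have := mul_le_mul_of_nonneg_left this (show 0 ≤ (p - 1) / 2 by linarith)
      nlinarith
  have h := hanti h1B ⟨hB, le_rfl⟩ hB
  simp only [Real.log_one, mul_zero, add_zero] at h
  have := (Real.rpow_pos_of_pos (hpos B ⟨hB, le_rfl⟩) (-((p - 1) / 2))).le
  linarith

/-- If `F' = D` and `D` grows at least like `c ∫ r⁻¹⁻ᵖ Fᵖ`, then `t D - F` grows at least like
`c ∫ (F / r)ᵖ`. -/
lemma integral_div_rpow_le_of_deriv_growth {p c B : ℝ} {F D : ℝ → ℝ}
    (hF : ContinuousOn F (Icc 1 B))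
    (hFD : ∀ t ∈ Ioo 1 B, HasDerivAt F (D t) t) (hpos : ∀ t ∈ Icc 1 B, 0 < F t)
    (hgrow : ∀ s t, 1 ≤ s → s ≤ t → t ≤ B → c * ∫ r in s..t, r ^ (-1 - p) * F r ^ p ≤ D t - D s)
    {s t : ℝ} (hs : 1 ≤ s) (hst : s ≤ t) (ht : t ≤ B) :
    c * ∫ r in s..t, (F r / r) ^ p ≤ (t * D t - F t) - (s * D s - F s) := by
  rcases hst.eq_or_lt with rfl | hst
  · simp
  have hsub : Icc s t ⊆ Icc 1 B := Icc_subset_Icc hs ht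
  have hne : ∀ r ∈ Icc s t, r ≠ 0 := fun r hr => by linarith [hr.1]
  set f : ℝ → ℝ := fun r => r ^ (-1 - p) * F r ^ p with hf
  have hfc : ContinuousOn f (Icc s t) :=
    (continuousOn_id.rpow_const fun r hr => Or.inl (hne r hr)).mul
      ((hF.mono hsub).rpow_const fun r hr => Or.inl (hpos r (hsub hr)).ne')
  have hprim : ∀ h : ℝ → ℝ, ContinuousOn h (Icc s t) →
      ContinuousOn (fun r => ∫ x in s..r, h x) (Icc s t) ∧
      ∀ r ∈ Ioo s t, HasDerivAt (fun r => ∫ x in s..r, h x) (h r) r := by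
    intro h hh
    refine ⟨?_, fun r hr => ?_⟩
    · have := intervalIntegral.continuousOn_primitive_interval (f := h) (μ := volume) (a := s)
        (b := t) (by rw [uIcc_of_le hst.le]; exact hh.integrableOn_Icc)
      rwa [uIcc_of_le hst.le] at this
    · refine intervalIntegral.integral_hasDerivAt_right ?_ ?_ ?_
      · exact (hh.mono (Icc_subset_Icc_right hr.2.le)).intervalIntegrable_of_Icc hr.1.le
      · exact (hh.mono Ioo_subset_Icc_self).stronglyMeasurableAtFilter isOpen_Ioo r hr
      · exact hh.continuousAt (Icc_mem_nhds hr.1 hr.2)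
  set Φ : ℝ → ℝ := fun r => ∫ x in s..r, f x with hΦ
  have hΦc : ContinuousOn Φ (Icc s t) := (hprim f hfc).1
  have hΦd : ∀ r ∈ Ioo s t, HasDerivAt Φ (f r) r := (hprim f hfc).2
  have hsplit : ∀ r ∈ Icc s t, Φ t - Φ r = ∫ x in r..t, f x := by
    intro r hr
    have i1 : IntervalIntegrable f volume s r :=
      (hfc.mono (Icc_subset_Icc_right hr.2)).intervalIntegrable_of_Icc hr.1
    have i2 : IntervalIntegrable f volume r t :=
      (hfc.mono (Icc_subset_Icc_left hr.1)).intervalIntegrable_of_Icc hr.2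
    have := intervalIntegral.integral_add_adjacent_intervals i1 i2
    simp only [hΦ]
    linarith
  -- integration by parts for the regular part
  have hparts : ∫ r in s..t, (F r / r) ^ p = t * Φ t - ∫ r in s..t, Φ r := by
    have hmc : ContinuousOn (fun r => r * Φ r - ∫ x in s..r, Φ x) (Icc s t) :=
      (continuousOn_id.mul hΦc).sub (hprim Φ hΦc).1
    have hmd : ∀ r ∈ Ioo s t, HasDerivAt (fun r => r * Φ r - ∫ x in s..r, Φ x)
        ((F r / r) ^ p) r := by
      intro r hr
      have := ((hasDerivAt_id r).mul (hΦd r hr)).sub ((hprim Φ hΦc).2 r hr)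
      refine this.congr_deriv ?_
      have hr0 : 0 < r := by linarith [hr.1]
      have hFr := hpos r (hsub (Ioo_subset_Icc_self hr))
      rw [show f r = r ^ (-1 - p) * F r ^ p from rfl, id, Real.div_rpow hFr.le hr0.le, show (-1 - p : ℝ) = -p + -1 by ring, Real.rpow_add hr0,
        Real.rpow_neg hr0.le, Real.rpow_neg_one]
      field_simp
      ring
    have hgc : ContinuousOn (fun r => (F r / r) ^ p) (Icc s t) :=
      ((hF.mono hsub).div continuousOn_id hne).rpow_const fun r hr =>
        Or.inl (div_ne_zero (hpos r (hsub hr)).ne' (hne r hr))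
    rw [intervalIntegral.integral_eq_sub_of_hasDerivAt_of_le hst.le hmc hmd
      (hgc.intervalIntegrable_of_Icc hst.le)]
    simp [hΦ]
  -- the mean value theorem for the remainder
  obtain ⟨r, hr, hrd⟩ := exists_hasDerivAt_eq_slope (fun r => F r - c * ∫ x in s..r, Φ x)
    (fun r => D r - c * Φ r) hst
    ((hF.mono hsub).sub (continuousOn_const.mul (hprim Φ hΦc).1))
    fun r hr => (hFD r ⟨by linarith [hr.1], by linarith [hr.2]⟩).sub
      (((hprim Φ hΦc).2 r hr).const_mul c)
  rw [eq_div_iff (by linarith)] at hrd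
  simp only [intervalIntegral.integral_same, mul_zero, sub_zero] at hrd
  have g1 := hgrow r t (by linarith [hr.1]) hr.2.le ht
  rw [← hsplit r (Ioo_subset_Icc_self hr)] at g1
  have g2 := hgrow s t hs hst.le ht
  rw [← hsplit s ⟨le_rfl, hst.le⟩] at g2
  have hΦs : Φ s = 0 := by simp [hΦ]
  rw [hΦs] at g2
  rw [hparts]
  have g3 : (D r - c * Φ r) * (t - s) ≤ (D t - c * Φ t) * (t - s) :=
    mul_le_mul_of_nonneg_right (by linarith) (by linarith)
  have g4 : 0 ≤ s * (D t - D s - c * Φ t) := mul_nonneg (by linarith) (by linarith)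
  nlinarith

/-- A critical Kato-type blow-up lemma: solutions of `F'' ≥ c t⁻¹⁻ᵖ |F|ᵖ` with initial data of
size `ε` live at most until `exp (C ε ^ (-(p - 1)))`. -/
lemma exists_log_le_of_deriv_growth {p c a b : ℝ} (hp : 1 < p) (hc : 0 < c) (ha : 0 < a)
    (hb : 0 < b) :
    ∃ C > 0, ∀ (ε B : ℝ) (F D : ℝ → ℝ), 0 < ε → ε ≤ 1 → 1 ≤ B →
      ContinuousOn F (Icc 1 B) → ContinuousOn D (Icc 1 B) →
      (∀ t ∈ Ioo 1 B, HasDerivAt F (D t) t) → F 1 = ε * a → D 1 = ε * b →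
      (∀ s t, 1 ≤ s → s ≤ t → t ≤ B →
        c * ∫ r in s..t, r ^ (-1 - p) * |F r| ^ p ≤ D t - D s) →
      Real.log B ≤ C * ε ^ (-(p - 1)) := by
  -- The factor one half leaves `b - m ≥ m`, so that `W(1) ≥ ε m` after the shift of `F` by `d`
  -- below.
  set m := min a b / 2 with hm
  have hm0 : 0 < m := by rw [hm]; positivity
  have hma : m ≤ a := by have := min_le_left a b; rw [hm]; linarith
  have hmb : 2 * m ≤ b := by have := min_le_right a b; rw [hm]; linarith
  -- The three entries serve, in order, the initial comparison, the bound `hκ₁` and the bound `hκ₂`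
  -- of `log_le_of_integral_growth`.
  set κ₀ : ℝ := min (m ^ (-((p - 1) / 2)))
    (min (c / 2 * m ^ ((p - 1) / 2)) (√(c / (p + 1)))) with hκ₀
  have hκ₀pos : 0 < κ₀ := by
    have : 0 < p + 1 := by linarith
    rw [hκ₀]; positivity
  refine ⟨m ^ (-((p - 1) / 2)) / ((p - 1) / 2 * κ₀), by
    have : 0 < p - 1 := by linarith
    positivity, ?_⟩
  intro ε B F D hε hε1 hB hF hD hFD hF1 hD1 hgrow
  have hFabs : ∀ s t, 1 ≤ s → s ≤ t → 0 ≤ ∫ r in s..t, r ^ (-1 - p) * |F r| ^ p := by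
    intro s t hs hst
    refine intervalIntegral.integral_nonneg hst fun r hr => ?_
    have : 0 < r := by linarith [hr.1]
    positivity
  have hDnn : ∀ t ∈ Icc 1 B, 0 ≤ D t := by
    intro t ht
    have h1 := hgrow 1 t le_rfl ht.1 ht.2
    have h2 := mul_nonneg hc.le (hFabs 1 t le_rfl ht.1)
    have : 0 < ε * b := by positivity
    linarith
  have hFm : MonotoneOn F (Icc 1 B) := by
    refine monotoneOn_of_hasDerivWithinAt_nonneg (convex_Icc 1 B) hF (f' := D) ?_ ?_
    · intro r hr
      rw [interior_Icc] at hr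
      exact (hFD r hr).hasDerivWithinAt
    · exact fun r hr => hDnn r (interior_subset hr)
  have hFlow : ∀ t ∈ Icc 1 B, ε * a ≤ F t := fun t ht => hF1 ▸ hFm ⟨le_rfl, hB⟩ ht ht.1
  -- `D 1 - F 1` may be negative. Lowering `F` by the constant `d` leaves its derivative unchanged,
  -- makes its initial value `ε m`, and keeps the growth inequality because `0 < F - d ≤ |F|`.
  set d := ε * a - ε * m with hd
  have hd0 : 0 ≤ d := by rw [hd]; nlinarith
  have hεm : 0 < ε * m := by positivity
  have hpos : ∀ t ∈ Icc 1 B, 0 < F t - d := fun t ht => by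
    have := hFlow t ht; rw [hd]; linarith
  have hFd : ContinuousOn (fun t => F t - d) (Icc 1 B) := hF.sub continuousOn_const
  have hgrow' : ∀ s t, 1 ≤ s → s ≤ t → t ≤ B →
      c * ∫ r in s..t, r ^ (-1 - p) * (F r - d) ^ p ≤ D t - D s := by
    intro s t hs hst ht
    refine le_trans (mul_le_mul_of_nonneg_left ?_ hc.le) (hgrow s t hs hst ht)
    have hsub : Icc s t ⊆ Icc 1 B := Icc_subset_Icc hs ht
    have hr0 : ContinuousOn (fun r : ℝ => r ^ (-1 - p)) (Icc s t) :=
      continuousOn_id.rpow_const fun r hr => Or.inl (zero_lt_one.trans_le (hs.trans hr.1)).ne'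
    refine intervalIntegral.integral_mono_on hst ?_ ?_ fun r hr => ?_
    · exact (hr0.mul ((hFd.mono hsub).rpow_const fun r hr =>
        Or.inl (hpos r (hsub hr)).ne')).intervalIntegrable_of_Icc hst
    · exact (hr0.mul ((hF.mono hsub).abs.rpow_const fun r hr =>
        Or.inr (by linarith))).intervalIntegrable_of_Icc hst
    · have h0 := (hpos r (hsub hr)).le
      have : 0 < r := by linarith [hr.1]
      gcongr
      exact (by linarith : F r - d ≤ F r).trans (le_abs_self _)
  -- This power of `ε` cancels `G(1)^(-(p-1)/2)` in `hκ₁`, where `G(1) = ε m`.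
  set κ := κ₀ * ε ^ ((p - 1) / 2) with hκ
  have hεp : 0 < ε ^ ((p - 1) / 2) := Real.rpow_pos_of_pos hε _
  have hεp1 : ε ^ ((p - 1) / 2) ≤ 1 := Real.rpow_le_one hε.le hε1 (by linarith)
  have hκpos : 0 < κ := by rw [hκ]; positivity
  have hG1 : (F 1 - d) / 1 = ε * m := by simp [hF1, hd]
  have hmain := log_le_of_integral_growth (p := p) (c := c) (κ := κ) (B := B)
    (G := fun t => (F t - d) / t) (W := fun t => t * D t - (F t - d)) hp hc.le hB
    (hFd.div continuousOn_id fun r hr => (zero_lt_one.trans_le hr.1).ne')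
    ((continuousOn_id.mul hD).sub hFd)
    (fun t ht => by
      have ht0 : t ≠ 0 := by linarith [ht.1]
      refine (((hFD t ht).sub_const d).div (hasDerivAt_id t) ht0).congr_deriv ?_
      simp only [id]
      ring)
    (fun t ht => div_pos (hpos t ht) (by linarith [ht.1])) hκpos
    (fun s t hs hst ht => integral_div_rpow_le_of_deriv_growth hFd
      (fun r hr => (hFD r hr).sub_const d) hpos hgrow' hs hst ht)
    (by
      rw [hG1]
      have e : (ε * m) ^ ((p + 1) / 2) = ε ^ ((p - 1) / 2) * m ^ ((p - 1) / 2) * (ε * m) := by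
        rw [← Real.mul_rpow hε.le hm0.le, ← Real.rpow_add_one hεm.ne']; congr 1; ring
      have h1 : κ₀ * m ^ ((p - 1) / 2) ≤ 1 := by
        calc κ₀ * m ^ ((p - 1) / 2) ≤ m ^ (-((p - 1) / 2)) * m ^ ((p - 1) / 2) := by
              gcongr; exact min_le_left _ _
          _ = 1 := by rw [← Real.rpow_add hm0]; simp
      calc κ * (ε * m) ^ ((p + 1) / 2)
          = (ε ^ ((p - 1) / 2) * ε ^ ((p - 1) / 2)) * (κ₀ * m ^ ((p - 1) / 2)) * (ε * m) := by
            rw [e, hκ]; ring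
        _ ≤ (1 * 1) * 1 * (ε * m) := by gcongr
        _ ≤ 1 * D 1 - (F 1 - d) := by rw [hF1, hD1, hd]; nlinarith)
    (by
      rw [hG1, Real.mul_rpow hε.le hm0.le, hκ]
      have e1 : ε ^ ((p - 1) / 2) * ε ^ (-((p - 1) / 2)) = 1 := by
        rw [← Real.rpow_add hε]; simp
      have e2 : m ^ ((p - 1) / 2) * m ^ (-((p - 1) / 2)) = 1 := by
        rw [← Real.rpow_add hm0]; simp
      calc κ₀ * ε ^ ((p - 1) / 2) * (ε ^ (-((p - 1) / 2)) * m ^ (-((p - 1) / 2)))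
          = (ε ^ ((p - 1) / 2) * ε ^ (-((p - 1) / 2))) * (κ₀ * m ^ (-((p - 1) / 2))) := by ring
        _ = κ₀ * m ^ (-((p - 1) / 2)) := by rw [e1, one_mul]
        _ ≤ (c / 2 * m ^ ((p - 1) / 2)) * m ^ (-((p - 1) / 2)) := by
            gcongr; exact (min_le_right _ _).trans (min_le_left _ _)
        _ = c / 2 := by rw [mul_assoc, e2, mul_one])
    (by
      have h1 : κ ≤ √(c / (p + 1)) := by
        calc κ ≤ κ₀ * 1 := by rw [hκ]; gcongr
          _ ≤ _ := by rw [mul_one]; exact (min_le_right _ _).trans (min_le_right _ _)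
      have hp1 : 0 < p + 1 := by linarith
      have h2 : κ ^ 2 ≤ c / (p + 1) := by
        calc κ ^ 2 ≤ √(c / (p + 1)) ^ 2 := by gcongr
          _ = _ := Real.sq_sqrt (by positivity)
      calc κ ^ 2 * ((p + 1) / 2) ≤ c / (p + 1) * ((p + 1) / 2) := by gcongr
        _ = c / 2 := by field_simp)
  rw [hG1, Real.mul_rpow hε.le hm0.le] at hmain
  have hp1 : 0 < (p - 1) / 2 := by linarith
  have hK : 0 < (p - 1) / 2 * κ := by positivity
  rw [← le_div_iff₀' hK] at hmain
  refine hmain.trans (le_of_eq ?_)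
  have e : ε ^ (-(p - 1)) = ε ^ (-((p - 1) / 2)) / ε ^ ((p - 1) / 2) := by
    rw [← Real.rpow_sub hε]; congr 1; ring
  rw [e, hκ]
  field_simp

/-! ### The light cone and Hölder's inequality -/

lemma A_eq {k t : ℝ} (hk : k < 1) : A k t = (t ^ (1 - k) - 1) / (1 - k) := by
  rw [A, integral_rpow (Or.inl (by linarith)), Real.one_rpow, show -k + 1 = 1 - k by ring]

lemma A_le_A {k s t : ℝ} (hk : k < 1) (hs : 1 ≤ s) (hst : s ≤ t) : A k s ≤ A k t := by
  have : 0 < 1 - k := by linarith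
  rw [A_eq hk, A_eq hk]
  gcongr

lemma A_nonneg {k t : ℝ} (hk : k < 1) (ht : 1 ≤ t) : 0 ≤ A k t := by
  have := A_le_A hk le_rfl ht
  rwa [show A k 1 = 0 by simp [A]] at this

lemma A_add_le {k R t : ℝ} (hk : k < 1) (hR : 0 < R) (ht : 1 ≤ t) :
    A k t + R ≤ (1 / (1 - k) + R) * t ^ (1 - k) := by
  have h0 : 0 < 1 - k := by linarith
  have h1 : 1 ≤ t ^ (1 - k) := Real.one_le_rpow ht h0.le
  rw [A_eq hk, add_mul, sub_div, one_div_mul_eq_div]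
  have : 0 < 1 / (1 - k) := by positivity
  nlinarith

/-- Hölder's inequality on a ball that carries `f`. -/
lemma abs_integral_mul_rpow_le {n : ℕ} {p ρ : ℝ} (hp : 1 < p) {f φ : Space n → ℝ}
    (hf : AEStronglyMeasurable f volume) (hsupp : ∀ᵐ x, ρ < ‖x‖ → f x = 0)
    (hφ : ∀ x, ‖x‖ ≤ ρ → φ x = 1) (hint : Integrable (fun x => |f x| ^ p * φ x)) :
    |∫ x, f x * φ x| ^ p
      ≤ (volume (Metric.closedBall (0 : Space n) ρ)).toReal ^ (p - 1)
        * ∫ x, |f x| ^ p * φ x := by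
  set b := Metric.closedBall (0 : Space n) ρ with hb
  have hbm : MeasurableSet b := Metric.isClosed_closedBall.measurableSet
  have hmem : ∀ x, x ∈ b ↔ ‖x‖ ≤ ρ := fun x => by simp [hb]
  have hbfin : volume b ≠ ⊤ := measure_closedBall_lt_top.ne
  have : IsFiniteMeasure (volume.restrict b) := ⟨by simpa using hbfin.lt_top⟩
  have hp0 : p ≠ 0 := by linarith
  have e1 : (fun x => f x * φ x) =ᵐ[volume] b.indicator f := by
    filter_upwards [hsupp] with x hx
    by_cases h : x ∈ b
    · rw [indicator_of_mem h, hφ x ((hmem x).1 h), mul_one]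
    · rw [indicator_of_notMem h, hx (not_le.1 ((hmem x).not.1 h)), zero_mul]
  have e2 : (fun x => |f x| ^ p * φ x) =ᵐ[volume] b.indicator fun x => |f x| ^ p := by
    filter_upwards [hsupp] with x hx
    by_cases h : x ∈ b
    · rw [indicator_of_mem h, hφ x ((hmem x).1 h), mul_one]
    · rw [indicator_of_notMem h, hx (not_le.1 ((hmem x).not.1 h)), abs_zero,
        Real.zero_rpow hp0, zero_mul]
  have hint' : Integrable (fun x => |f x| ^ p) (volume.restrict b) :=
    (integrable_indicator_iff hbm).1 (hint.congr e2)
  rw [integral_congr_ae e1, integral_congr_ae e2, integral_indicator hbm, integral_indicator hbm]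
  have hpq := Real.HolderConjugate.conjExponent hp
  have hofp : (ENNReal.ofReal p).toReal = p := ENNReal.toReal_ofReal (by linarith)
  have hfL : MemLp f (ENNReal.ofReal p) (volume.restrict b) := by
    rw [← integrable_norm_rpow_iff hf.restrict (by simp; linarith) (by simp), hofp]
    simpa [Real.norm_eq_abs] using hint'
  have hH := integral_mul_norm_le_Lp_mul_Lq (μ := volume.restrict b) (g := fun _ => (1 : ℝ)) hpq
    hfL (memLp_const 1)
  simp only [norm_one, mul_one, Real.one_rpow, integral_const, smul_eq_mul,
    measureReal_restrict_apply_univ, Real.norm_eq_abs] at hH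
  have hV : 0 ≤ volume.real b := measureReal_nonneg
  have hI : 0 ≤ ∫ x in b, |f x| ^ p := integral_nonneg fun x => by positivity
  have hp' : 0 < p := by linarith
  calc |∫ x in b, f x| ^ p ≤ (∫ x in b, |f x|) ^ p := by
        gcongr; exact abs_integral_le_integral_abs
    _ ≤ ((∫ x in b, |f x| ^ p) ^ (1 / p) * volume.real b ^ (1 / p.conjExponent)) ^ p := by
        refine Real.rpow_le_rpow (integral_nonneg fun x => abs_nonneg _) hH hp'.le
    _ = (volume b).toReal ^ (p - 1) * ∫ x in b, |f x| ^ p := by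
        rw [Real.mul_rpow (by positivity) (by positivity), ← Real.rpow_mul hI,
          ← Real.rpow_mul hV, one_div_mul_cancel hp0, Real.rpow_one, mul_comm]
        congr 2
        rw [Real.conjExponent]
        have : p - 1 ≠ 0 := by linarith
        field_simp

/-! ### Testing the weak formulation with a spatial cut-off -/

/-- The gradient of a function supported in a ball is orthogonal to the gradients of cut-offs
of that ball. -/
lemma integral_inner_grad_bump_eq_zero {n : ℕ} (u : H1 n) {r : ℝ} (hu : SupportedInBall u.fn r)
    (φ : ContDiffBump (0 : Space n)) (hr : r < φ.rIn) :
    ∫ x, inner ℝ (u.grad x) (∇ (φ : Space n → ℝ) x) = 0 := by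
  have hφs : ContDiff ℝ ∞ (φ : Space n → ℝ) := φ.contDiff
  have hterm : ∀ i : Fin n,
      ∫ x, u.grad x i * fderiv ℝ φ x (EuclideanSpace.single i 1) = 0 := by
    intro i
    have hs : ContDiff ℝ ∞ fun x => fderiv ℝ φ x (EuclideanSpace.single i 1) :=
      (hφs.fderiv_right (m := ∞) (by simp)).clm_apply contDiff_const
    -- Testing the weak gradient with `∂ᵢφ` leaves `∫ u ∂ᵢ²φ`. The strict inequality `r < φ.rIn`
    -- makes `φ` constant near each point of the ball of radius `r`, so this integral vanishes.
    have h := u.2 _ hs (hasCompactSupport_partial φ.hasCompactSupport i) i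
    have h0 : ∫ x, u.1.fst x * fderiv ℝ
        (fun x => fderiv ℝ φ x (EuclideanSpace.single i 1)) x (EuclideanSpace.single i 1) = 0 := by
      refine integral_eq_zero_of_ae ?_
      filter_upwards [hu] with x hx
      rcases lt_or_ge r ‖x‖ with hxr | hxr
      · have : u.1.fst x = 0 := hx hxr
        simp [this]
      · have hxb : x ∈ Metric.ball (0 : Space n) φ.rIn := by simpa using hxr.trans_lt hr
        have h1 : (φ : Space n → ℝ) =ᶠ[nhds x] 1 := φ.eventuallyEq_one_of_mem_ball hxb
        have h2 : (fun x => fderiv ℝ φ x (EuclideanSpace.single i 1)) =ᶠ[nhds x]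
            fun _ => (0 : ℝ) := by
          filter_upwards [h1.fderiv (𝕜 := ℝ)] with y hy
          rw [hy]
          simp
        rw [h2.fderiv_eq]
        simp
    rw [h0] at h
    exact neg_eq_zero.1 h.symm
  have hexp : ∀ x, inner ℝ (u.grad x) (∇ (φ : Space n → ℝ) x)
      = ∑ i, u.grad x i * fderiv ℝ φ x (EuclideanSpace.single i 1) := by
    intro x
    rw [PiLp.inner_apply]
    refine Finset.sum_congr rfl fun i _ => ?_
    have : ∇ (φ : Space n → ℝ) x i = fderiv ℝ φ x (EuclideanSpace.single i 1) := by
      rw [← inner_gradient_left, EuclideanSpace.inner_single_right]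
      simp
    rw [this]
    simp [mul_comm]
  simp_rw [hexp]
  rw [integral_finsetSum]
  · exact Finset.sum_eq_zero fun i _ => hterm i
  · intro i _
    exact integrable_mul_test (memLp_coord u.grad i) (continuous_partial hφs i)
      (hasCompactSupport_partial φ.hasCompactSupport i)

/-- Fubini for the nonlinearity of a curve in `L^p_loc`. -/
lemma MemLpLoc.integrable_nonlinearity {n : ℕ} {p B : ℝ} {T : EReal} {u : ℝ → H1 n}
    (hp : 1 < p) (hu : MemLpLoc p T u) (hB : (B : EReal) < T) {φ : Space n → ℝ}
    (hφ : Continuous φ) (hφc : HasCompactSupport φ) :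
    IntegrableOn (fun s => ∫ x, s ^ (1 - p) * |(u s).fn x| ^ p * φ x) (Icc 1 B) ∧
    ∀ᵐ s ∂(volume.restrict (Icc 1 B)), Integrable fun x => |(u s).fn x| ^ p * φ x := by
  obtain ⟨U, hUu, hU⟩ := hu
  have hK : IsCompact (Icc 1 B ×ˢ tsupport φ) := isCompact_Icc.prod hφc
  have hL := hU (Icc 1 B ×ˢ tsupport φ) hK fun z hz =>
    ⟨⟨hz.1.1, lt_of_le_of_lt (EReal.coe_le_coe_iff.2 hz.1.2) hB⟩, mem_univ _⟩
  have h1 := hL.integrable_norm_rpow (by simp; linarith) (by simp)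
  rw [ENNReal.toReal_ofReal (by linarith)] at h1
  have hw : ContinuousOn (fun z : ℝ × Space n => z.1 ^ (1 - p) * φ z.2)
      (Icc 1 B ×ˢ tsupport φ) := by
    refine ContinuousOn.mul ?_ (by fun_prop)
    exact continuousOn_fst.rpow_const fun z hz => Or.inl (zero_lt_one.trans_le hz.1.1).ne'
  have h2 : Integrable (fun z : ℝ × Space n => ‖U z‖ ^ p * (z.1 ^ (1 - p) * φ z.2))
      (volume.restrict (Icc 1 B ×ˢ tsupport φ)) :=
    IntegrableOn.mul_continuousOn h1 hw hK
  have hprod : volume.restrict (Icc 1 B ×ˢ tsupport φ)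
      = ((volume : Measure ℝ).restrict (Icc 1 B)).prod
          ((volume : Measure (Space n)).restrict (tsupport φ)) := by
    rw [Measure.prod_restrict, Measure.volume_eq_prod]
  rw [hprod] at h2
  have hset : ∀ s, (∫ x, s ^ (1 - p) * |(u s).fn x| ^ p * φ x)
      = ∫ x in tsupport φ, s ^ (1 - p) * |(u s).fn x| ^ p * φ x := by
    intro s
    refine (setIntegral_eq_integral_of_forall_compl_eq_zero fun x hx => ?_).symm
    rw [image_eq_zero_of_notMem_tsupport hx, mul_zero]
  -- The jointly measurable representative `U` makes Fubini applicable; agreement of slices at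
  -- almost every time suffices for both conclusions.
  have hUu' : ∀ᵐ s ∂(volume.restrict (Icc 1 B)), (fun x => U (s, x)) =ᵐ[volume] (u s).fn := by
    rw [ae_restrict_iff' measurableSet_Icc]
    filter_upwards [hUu] with s hs hsB
    exact hs ⟨hsB.1, lt_of_le_of_lt (EReal.coe_le_coe_iff.2 hsB.2) hB⟩
  have hae : ∀ᵐ s ∂(volume.restrict (Icc 1 B)),
      (fun x => ‖U (s, x)‖ ^ p * (s ^ (1 - p) * φ x))
        =ᵐ[volume] fun x => s ^ (1 - p) * |(u s).fn x| ^ p * φ x := by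
    filter_upwards [hUu'] with s hs
    filter_upwards [hs] with x hx
    rw [hx, Real.norm_eq_abs]
    ring
  constructor
  · refine h2.integral_prod_left.congr ?_
    filter_upwards [hae] with s hs
    rw [hset]
    exact integral_congr_ae (ae_restrict_of_ae hs)
  · filter_upwards [hae, h2.prod_right_ae, ae_restrict_mem measurableSet_Icc] with s hs hi hsB
    have h3 : IntegrableOn (fun x => s ^ (1 - p) * |(u s).fn x| ^ p * φ x) (tsupport φ) :=
      hi.congr (ae_restrict_of_ae hs)
    have h4 : Integrable (fun x => s ^ (1 - p) * |(u s).fn x| ^ p * φ x) := by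
      refine (integrableOn_iff_integrable_of_support_subset fun x hx => ?_).1 h3
      by_contra h
      exact hx (by simp [image_eq_zero_of_notMem_tsupport h])
    have hs0 : s ^ (1 - p) ≠ 0 := (Real.rpow_pos_of_pos (zero_lt_one.trans_le hsB.1) _).ne'
    refine (h4.const_mul (s ^ (1 - p))⁻¹).congr (Filter.Eventually.of_forall fun x => ?_)
    simp only
    field_simp

/-- The weak formulation tested with a spatial cut-off that equals one on the support of `u`. -/
lemma IsEnergySolution.integral_timeDeriv_mul_bump {n : ℕ} {k p ε R B : ℝ} {u₀ : H1 n}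
    {u₁ : L2 n} {T : EReal} {u : ℝ → H1 n} (hk : k < 1)
    (hu : IsEnergySolution k p ε u₀ u₁ T u) (hcone : HasConeSupport k R T u)
    (hBT : (B : EReal) < T) (φ : ContDiffBump (0 : Space n)) (hφ : A k B + R < φ.rIn)
    {t : ℝ} (ht1 : 1 < t) (htB : t ≤ B) :
    ∫ x, timeDeriv T u t x * φ x = ε * (∫ x, u₁ x * φ x)
      + ∫ s in (1 : ℝ)..t, ∫ x, s ^ (1 - p) * |(u s).fn x| ^ p * φ x := by
  obtain ⟨c, hBc, hcT⟩ := EReal.lt_iff_exists_real_btwn.1 hBT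
  have hBc' : B < c := EReal.coe_lt_coe_iff.1 hBc
  have hB0 : 0 < B := by linarith
  -- A test function must vanish before `T`, so `φ` is multiplied by a cut-off in time that is one
  -- near `[1, t]` and supported in `|s| ≤ c < T`.
  let χ : ContDiffBump (0 : ℝ) := ⟨(B + c) / 2, c, by linarith, by linarith⟩
  have hχ : ∀ s ∈ Icc 1 t, (χ : ℝ → ℝ) =ᶠ[nhds s] 1 := by
    intro s hs
    refine χ.eventuallyEq_one_of_mem_ball ?_
    rw [Metric.mem_ball, Real.dist_eq, sub_zero, abs_of_pos (by linarith [hs.1])]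
    change s < (B + c) / 2
    linarith [hs.2]
  have hχ1 : ∀ s ∈ Icc 1 t, χ s = 1 := fun s hs => (hχ s hs).eq_of_nhds
  set ψ : ℝ × Space n → ℝ := fun z => χ z.1 * φ z.2 with hψ
  have hsub : tsupport ψ ⊆ Metric.closedBall (0 : ℝ) c ×ˢ tsupport (φ : Space n → ℝ) := by
    refine closure_minimal (fun z hz => ?_) (Metric.isClosed_closedBall.prod (isClosed_tsupport _))
    have hz : χ z.1 * φ z.2 ≠ 0 := hz
    refine ⟨?_, subset_tsupport _ (right_ne_zero_of_mul hz)⟩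
    have : z.1 ∈ Function.support χ := left_ne_zero_of_mul hz
    rw [χ.support_eq] at this
    exact Metric.ball_subset_closedBall this
  have htest : IsTestFunction T ψ := by
    refine ⟨?_, ?_, ?_⟩
    · exact (χ.contDiff.comp contDiff_fst).mul (φ.contDiff.comp contDiff_snd)
    · exact ((isCompact_closedBall (0 : ℝ) c).prod φ.hasCompactSupport).of_isClosed_subset
        (isClosed_tsupport _) hsub
    · intro z hz
      have := (hsub hz).1
      rw [Metric.mem_closedBall, Real.dist_eq, sub_zero] at this
      exact lt_of_le_of_lt (EReal.coe_le_coe_iff.2 ((le_abs_self _).trans this)) hcT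
  have h := hu.integral_eq ψ htest t ht1
    (lt_of_le_of_lt (EReal.coe_le_coe_iff.2 htB) hBT)
  have hψt : ∀ s ∈ Icc 1 t, ∀ x, ψ (s, x) = φ x := fun s hs x => by
    simp only [hψ, hχ1 s hs, one_mul]
  -- On `[1, t]` the test function does not depend on time, and its gradient integrates to zero
  -- against that of `u` by the support condition.
  have hzero : (∫ s in (1 : ℝ)..t, ∫ x,
      (timeDeriv T u s x * deriv (fun r => ψ (r, x)) s
        - s ^ (-2 * k) * inner ℝ ((u s).grad x) (∇ (fun y => ψ (s, y)) x))) = 0 := by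
    rw [intervalIntegral.integral_of_le ht1.le]
    refine setIntegral_eq_zero_of_forall_eq_zero fun s hs => ?_
    have hsI : s ∈ Icc 1 t := Ioc_subset_Icc_self hs
    have hd : ∀ x, deriv (fun r => ψ (r, x)) s = 0 := by
      intro x
      have : (fun r => ψ (r, x)) =ᶠ[nhds s] fun _ => φ x := by
        filter_upwards [hχ s hsI] with r hr
        simp [hψ, hr]
      rw [this.deriv_eq, deriv_const]
    have hfun : (fun y => ψ (s, y)) = φ := funext (hψt s hsI)
    simp_rw [hd, hfun, mul_zero, zero_sub]
    rw [integral_neg, integral_const_mul, integral_inner_grad_bump_eq_zero (u s)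
      (hcone s hs.1 (lt_of_le_of_lt (EReal.coe_le_coe_iff.2 (hs.2.trans htB)) hBT)) φ, mul_zero,
      neg_zero]
    have := A_le_A hk hsI.1 (hsI.2.trans htB)
    linarith
  have hrhs : (∫ s in (1 : ℝ)..t, ∫ x, s ^ (1 - p) * |(u s).fn x| ^ p * ψ (s, x))
      = ∫ s in (1 : ℝ)..t, ∫ x, s ^ (1 - p) * |(u s).fn x| ^ p * φ x := by
    refine intervalIntegral.integral_congr fun s hs => ?_
    rw [uIcc_of_le ht1.le] at hs
    simp only [hψt s hs]
  rw [hzero, hrhs] at h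
  simp only [hψt t ⟨ht1.le, le_rfl⟩, hψt 1 ⟨le_rfl, ht1.le⟩] at h
  linarith

/-! ### The spatial mean as an `L²` pairing -/

lemma inner_bump_toLp {n : ℕ} (φ : ContDiffBump (0 : Space n)) (f : L2 n) :
    inner ℝ ((φ.continuous.memLp_of_hasCompactSupport (μ := volume) (p := 2)
      φ.hasCompactSupport).toLp (φ : Space n → ℝ)) f = ∫ x, f x * φ x := by
  rw [L2.inner_def]
  refine integral_congr_ae ?_
  filter_upwards [(φ.continuous.memLp_of_hasCompactSupport (μ := volume) (p := 2)
    φ.hasCompactSupport).coeFn_toLp] with x hx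
  rw [hx]
  simp

lemma mul_bump_ae_eq {n : ℕ} {f : L2 n} {r : ℝ} (hf : SupportedInBall f r)
    (φ : ContDiffBump (0 : Space n)) (hr : r ≤ φ.rIn) : (fun x => f x * φ x) =ᵐ[volume] f := by
  filter_upwards [hf] with x hx
  rcases lt_or_ge r ‖x‖ with h | h
  · rw [hx h, zero_mul]
  · rw [φ.one_of_mem_closedBall (by simpa using h.trans hr), mul_one]

lemma integral_pos_of_supportedInBall {n : ℕ} {f : L2 n} {r : ℝ} (hr : 0 < r)
    (hf : SupportedInBall f r) (hnn : ∀ᵐ x, 0 ≤ f x) (hne : f ≠ 0) : 0 < ∫ x, f x := by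
  let φ : ContDiffBump (0 : Space n) := ⟨r, r + 1, hr, by linarith⟩
  have hint : Integrable f volume :=
    (integrable_mul_test (Lp.memLp f) φ.continuous φ.hasCompactSupport).congr
      (mul_bump_ae_eq hf φ le_rfl)
  refine (integral_nonneg_of_ae hnn).lt_of_ne fun h => hne ?_
  exact (Lp.eq_zero_iff_ae_eq_zero).2 ((integral_eq_zero_iff_of_nonneg_ae hnn hint).1 h.symm)

lemma hasDerivAt_fn {n : ℕ} {k p ε : ℝ} {u₀ : H1 n} {u₁ : L2 n} {T : EReal} {u : ℝ → H1 n}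
    (hu : IsEnergySolution k p ε u₀ u₁ T u) {t : ℝ} (ht : 1 < t) (htT : (t : EReal) < T) :
    HasDerivAt (fun s => (u s).fn) (timeDeriv T u t) t := by
  have hnhds : timeInterval T ∈ nhds t := by
    have h1 : Ioi (1 : ℝ) ∈ nhds t := Ioi_mem_nhds ht
    have h2 : {s : ℝ | (s : EReal) < T} ∈ nhds t :=
      (isOpen_Iio.preimage continuous_coe_real_ereal).mem_nhds htT
    filter_upwards [h1, h2] with s hs1 hs2 using ⟨le_of_lt hs1, hs2⟩
  exact ((hu.contDiff_L2.differentiableOn (by simp)) t ⟨ht.le, htT⟩).hasDerivWithinAt.hasDerivAt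
    hnhds

/-! ### The critical exponent and the lifespan bound -/

/-- The cone has radius of order `s^(1-k)`, and `n (1-k) (p-1) = 2` is exactly the definition of
`p₁`. The resulting `s²` turns the weight `s^(1-p)` into the critical `s^(-1-p)`. -/
lemma volume_closedBall_rpow_le {n : ℕ} (hn : 1 ≤ n) {k p R s : ℝ} (hk : k < 1)
    (hp : p = p₁ n k) (hR : 0 < R) (hs : 1 ≤ s) :
    (volume (Metric.closedBall (0 : Space n) (A k s + R))).toReal ^ (p - 1)
      ≤ ((1 / (1 - k) + R) ^ n * (volume (Metric.ball (0 : Space n) 1)).toReal) ^ (p - 1)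
        * s ^ (2 : ℝ) := by
  have h0 : 0 < 1 - k := by linarith
  have hs0 : 0 < s := by linarith
  have hn0 : (0 : ℝ) < n := by exact_mod_cast hn
  have hp1 : p - 1 = 2 / ((1 - k) * n) := by rw [hp, p₁]; ring
  have hp0 : 0 ≤ p - 1 := by rw [hp1]; positivity
  have hA := A_nonneg hk hs
  rw [Measure.addHaar_closedBall _ _ (by linarith), ENNReal.toReal_mul,
    ENNReal.toReal_ofReal (by positivity), finrank_euclideanSpace_fin]
  have e : s ^ (2 : ℝ) = ((s ^ (1 - k)) ^ n) ^ (p - 1) := by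
    rw [← Real.rpow_natCast, ← Real.rpow_mul hs0.le, ← Real.rpow_mul hs0.le, hp1]
    congr 1
    field_simp
  rw [e, ← Real.mul_rpow (by positivity) (by positivity)]
  refine Real.rpow_le_rpow (by positivity) ?_ hp0
  calc (A k s + R) ^ n * (volume (Metric.ball (0 : Space n) 1)).toReal
      ≤ ((1 / (1 - k) + R) * s ^ (1 - k)) ^ n
        * (volume (Metric.ball (0 : Space n) 1)).toReal := by
        gcongr; exact A_add_le hk hR hs
    _ = _ := by rw [mul_pow]; ring

/-- The constant comes from the masses of the data and from `M`. The cut-off depends on `B`, but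
only the volume of the cone section at each time enters the estimate, so `C` does not. -/
lemma exists_log_le_of_isEnergySolution {n : ℕ} (hn : 1 ≤ n) {k p R : ℝ} (hk1 : k < 1)
    (hp : p = p₁ n k) (hR : 0 < R) {u₀ : H1 n} {u₁ : L2 n}
    (hu₀_nonneg : ∀ᵐ x : Space n, 0 ≤ u₀.fn x) (hu₁_nonneg : ∀ᵐ x : Space n, 0 ≤ u₁ x)
    (hu₀_ne : u₀.fn ≠ 0) (hu₁_ne : u₁ ≠ 0)
    (hu₀_supp : SupportedInBall u₀.fn R) (hu₁_supp : SupportedInBall u₁ R) :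
    ∃ C > 0, ∀ (ε B : ℝ) (T : EReal) (u : ℝ → H1 n), 0 < ε → ε ≤ 1 →
      IsEnergySolution k p ε u₀ u₁ T u → HasConeSupport k R T u → 1 ≤ B → (B : EReal) < T →
        Real.log B ≤ C * ε ^ (-(p - 1)) := by
  have h0 : 0 < 1 - k := by linarith
  have hn0 : (0 : ℝ) < n := by exact_mod_cast hn
  have hp1 : 1 < p := by
    rw [hp, p₁]
    have : 0 < 2 / ((1 - k) * n) := by positivity
    linarith
  set M := ((1 / (1 - k) + R) ^ n * (volume (Metric.ball (0 : Space n) 1)).toReal) ^ (p - 1)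
    with hM
  have hV : 0 < (volume (Metric.ball (0 : Space n) 1)).toReal :=
    ENNReal.toReal_pos (Metric.measure_ball_pos _ _ one_pos).ne' measure_ball_lt_top.ne
  have hM0 : 0 < M := by rw [hM]; positivity
  obtain ⟨C, hC, hode⟩ := exists_log_le_of_deriv_growth (p := p) (c := M⁻¹) hp1 (by positivity)
    (integral_pos_of_supportedInBall hR hu₀_supp hu₀_nonneg hu₀_ne)
    (integral_pos_of_supportedInBall hR hu₁_supp hu₁_nonneg hu₁_ne)
  refine ⟨C, hC, fun ε B T u hε hε1 hu hcone hB hBT => ?_⟩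
  have hAB := A_nonneg hk1 hB
  let φ : ContDiffBump (0 : Space n) :=
    ⟨A k B + R + 1, A k B + R + 2, by linarith, by linarith⟩
  have hφin : φ.rIn = A k B + R + 1 := rfl
  set φL := (φ.continuous.memLp_of_hasCompactSupport (μ := volume) (p := 2)
      φ.hasCompactSupport).toLp (φ : Space n → ℝ) with hφL
  obtain ⟨hint, hae⟩ := hu.memLpLoc.integrable_nonlinearity hp1 hBT φ.continuous
    φ.hasCompactSupport
  set h : ℝ → ℝ := fun s => ∫ x, s ^ (1 - p) * |(u s).fn x| ^ p * φ x with hh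
  -- Written as a pairing with a fixed `L²` element, the mean inherits continuity and
  -- differentiability from the curve in `L²`.
  set F : ℝ → ℝ := fun t => inner ℝ φL (u t).fn with hF
  have hltT : ∀ t, t ≤ B → (t : EReal) < T := fun t ht =>
    lt_of_le_of_lt (EReal.coe_le_coe_iff.2 ht) hBT
  have hFc : ContinuousOn F (Icc 1 B) := by
    have h1 : ContinuousOn (fun t => (u t).fn) (Icc 1 B) :=
      hu.contDiff_L2.continuousOn.mono fun t ht => ⟨ht.1, hltT t ht.2⟩
    exact (innerSL ℝ φL).continuous.comp_continuousOn h1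
  have hhi : ∀ s t, 1 ≤ s → s ≤ t → t ≤ B → IntervalIntegrable h volume s t := by
    intro s t hs hst ht
    rw [intervalIntegrable_iff_integrableOn_Icc_of_le hst]
    exact hint.mono_set (Icc_subset_Icc hs ht)
  -- The derivative is given by the integrated weak formulation, which extends continuously to `t =
  -- 1` with the value `ε ∫ u₁`. Its integrand is merely integrable in time, hence the integral form
  -- of the growth hypothesis.
  refine hode ε B F (fun t => ε * (∫ x, u₁ x) + ∫ s in (1 : ℝ)..t, h s) hε hε1 hB hFc
    ?_ ?_ ?_ ?_ ?_
  · refine continuousOn_const.add ?_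
    have := intervalIntegral.continuousOn_primitive_interval (f := h) (μ := volume) (a := 1)
      (b := B) (by rwa [uIcc_of_le hB])
    rwa [uIcc_of_le hB] at this
  · intro t ht
    have h1 := (innerSL ℝ φL).hasFDerivAt.comp_hasDerivAt t
      (hasDerivAt_fn hu ht.1 (hltT t ht.2.le))
    refine h1.congr_deriv ?_
    rw [innerSL_apply_apply, hφL, inner_bump_toLp,
      hu.integral_timeDeriv_mul_bump hk1 hcone hBT φ (by rw [hφin]; linarith) ht.1 ht.2.le,
      integral_congr_ae (mul_bump_ae_eq hu₁_supp φ (by rw [hφin]; linarith))]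
  · have : (u 1).fn = ε • u₀.fn := by rw [hu.initial]; rfl
    simp only [hF]
    rw [this, inner_smul_right, hφL, inner_bump_toLp,
      integral_congr_ae (mul_bump_ae_eq hu₀_supp φ (by rw [hφin]; linarith))]
  · simp
  · intro s t hs hst ht
    have hsplit : (ε * (∫ x, u₁ x) + ∫ r in (1 : ℝ)..t, h r)
        - (ε * (∫ x, u₁ x) + ∫ r in (1 : ℝ)..s, h r) = ∫ r in s..t, h r := by
      rw [← intervalIntegral.integral_add_adjacent_intervals
        (hhi 1 s le_rfl hs (hst.trans ht)) (hhi s t hs hst ht)]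
      ring
    rw [hsplit, ← intervalIntegral.integral_const_mul]
    have hsub : Icc s t ⊆ Icc 1 B := Icc_subset_Icc hs ht
    refine intervalIntegral.integral_mono_ae_restrict hst ?_ (hhi s t hs hst ht) ?_
    · refine ContinuousOn.intervalIntegrable_of_Icc hst (continuousOn_const.mul
        ((continuousOn_id.rpow_const fun r hr => Or.inl ?_).mul
          ((hFc.mono hsub).abs.rpow_const fun r hr => Or.inr (by linarith))))
      exact (zero_lt_one.trans_le (hs.trans hr.1)).ne'
    · have hne : ∀ᵐ r ∂(volume.restrict (Icc s t)), r ≠ 1 :=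
        ae_restrict_of_ae (compl_mem_ae_iff.2 (measure_singleton 1))
      filter_upwards [ae_restrict_of_ae_restrict_of_subset hsub hae, hne,
        ae_restrict_mem measurableSet_Icc] with r hr hr1 hrst
      have hrB := hsub hrst
      have hr0 : 0 < r := zero_lt_one.trans_le hrB.1
      have hH := abs_integral_mul_rpow_le hp1 (Lp.aestronglyMeasurable (u r).fn)
        (hcone r (lt_of_le_of_ne hrB.1 (Ne.symm hr1)) (hltT r hrB.2))
        (φ := φ) (fun x hx => φ.one_of_mem_closedBall (by
          have := A_le_A hk1 hrB.1 hrB.2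
          rw [mem_closedBall_zero_iff, hφin]
          linarith)) hr
      have hI : 0 ≤ ∫ x, |(u r).fn x| ^ p * φ x :=
        integral_nonneg fun x => mul_nonneg (by positivity) φ.nonneg
      have hFr : F r = ∫ x, (u r).fn x * φ x := inner_bump_toLp φ _
      have hhr : h r = r ^ (1 - p) * ∫ x, |(u r).fn x| ^ p * φ x := by
        rw [hh, ← integral_const_mul]
        simp only [mul_assoc]
      have hvol := volume_closedBall_rpow_le hn hk1 hp hR hrB.1
      rw [← hM] at hvol
      have e : r ^ (-1 - p) * r ^ (2 : ℝ) = r ^ (1 - p) := by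
        rw [← Real.rpow_add hr0]; congr 1; ring
      calc M⁻¹ * (r ^ (-1 - p) * |F r| ^ p)
          ≤ M⁻¹ * (r ^ (-1 - p) * (M * r ^ (2 : ℝ) * ∫ x, |(u r).fn x| ^ p * φ x)) := by
            rw [hFr]
            gcongr
            exact hH.trans (by gcongr)
        _ = r ^ (-1 - p) * r ^ (2 : ℝ) * ∫ x, |(u r).fn x| ^ p * φ x := by
            field_simp
        _ = h r := by rw [e, hhr]

end EdeS

theorem theorem1p2 (n : ℕ) (hn : 1 ≤ n) (k : ℝ) (hk0 : 0 ≤ k) (hk1 : k < 1)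
    (hnN : (n : ℝ) ≤ EdeS.N k) (p : ℝ) (hp : p = EdeS.p₁ n k)
    (R : ℝ) (hR : 0 < R) (u₀ : EdeS.H1 n) (u₁ : EdeS.L2 n)
    (hu₀_nonneg : ∀ᵐ x : EdeS.Space n, 0 ≤ u₀.fn x)
    (hu₁_nonneg : ∀ᵐ x : EdeS.Space n, 0 ≤ u₁ x)
    (hu₀_ne : u₀.fn ≠ 0) (hu₁_ne : u₁ ≠ 0)
    (hu₀_supp : EdeS.SupportedInBall u₀.fn R) (hu₁_supp : EdeS.SupportedInBall u₁ R) :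
    ∃ ε₀ > 0, ∃ C > 0, ∀ ε : ℝ, 0 < ε → ε ≤ ε₀ →
      (∀ (T : EReal) (u : ℝ → EdeS.H1 n), EdeS.IsEnergySolution k p ε u₀ u₁ T u →
        EdeS.HasConeSupport k R T u →
          T < ⊤ ∧ T ≤ ((Real.exp (C * ε ^ (-(p - 1))) : ℝ) : EReal)) ∧
      EdeS.lifespan k p R u₀ u₁ ε ≤ ((Real.exp (C * ε ^ (-(p - 1))) : ℝ) : EReal) := by
  obtain ⟨C, hC, hlog⟩ := EdeS.exists_log_le_of_isEnergySolution hn hk1 hp hR hu₀_nonneg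
    hu₁_nonneg hu₀_ne hu₁_ne hu₀_supp hu₁_supp
  refine ⟨1, one_pos, C, hC, fun ε hε hε1 => ?_⟩
  have hbound : ∀ (T : EReal) (u : ℝ → EdeS.H1 n), EdeS.IsEnergySolution k p ε u₀ u₁ T u →
      EdeS.HasConeSupport k R T u → T ≤ ((Real.exp (C * ε ^ (-(p - 1))) : ℝ) : EReal) := by
    intro T u hu hcone
    by_contra! hlt
    -- A real time strictly between the bound and `T` treats finite and infinite `T` together.
    obtain ⟨B, hB, hBT⟩ := EReal.lt_iff_exists_real_btwn.1 hlt
    rw [EReal.coe_lt_coe_iff] at hB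
    have h1 : 1 ≤ Real.exp (C * ε ^ (-(p - 1))) := Real.one_le_exp (by positivity)
    have h2 := hlog ε B T u hε hε1 hu hcone (h1.trans hB.le) hBT
    rw [Real.log_le_iff_le_exp (by linarith)] at h2
    linarith
  refine ⟨fun T u hu hcone => ⟨(hbound T u hu hcone).trans_lt (EReal.coe_lt_top _),
    hbound T u hu hcone⟩, sSup_le ?_⟩
  rintro T ⟨u, hu, hcone⟩
  exact hbound T u hu hcone
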